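/- **Parallel I/O lower bound for LU factorization.** *The cDAG.* Consider the in-place LU factorization (no pivoting) of an $N\times N$ array $A$: for $k=1,\dots,N$, first (S1) $A[i,k]\leftarrow A[i,k]/A[k,k]$ for $k<i\le N$, and then (S2) $A[i,j]\leftarrow A[i,j]-A[i,k]\,A[k,j]$ for $k<i,j\le N$. Its computational DAG has one vertex for each version of each array element (the initial version and the version after each update), and an edge to each updated version from each version read by that update. The inputs are the vertices without incoming edges, i.e. the initial versions; the outputs are the final versions of all $N^2$ elements, i.e. the entries of the two triangular factors. *The game.* In the parallel red-blue pebble game with $P\ge 1$ processors and $M$ pebbles per processor, each processor $p$ has its own colour, and at no time may more than $M$ pebbles of one processor be on the graph; blue pebbles (slow memory) are unlimited. The moves are: (compute) if all direct predecessors of a non-input vertex $v$ carry pebbles of $p$, a pebble of $p$ may be placed on $v$; (load) if $v$ carries any pebble, blue or of any processor, a pebble of $p$ may be placed on $v$; (store) if $v$ carries a pebble of $p$, a blue pebble may be placed on $v$; pebbles may be removed at any time. Loads and stores by $p$ are the I/O operations of $p$; recomputation is allowed. A pebbling starts with blue pebbles on exactly the inputs and no other pebbles, and ends with a blue pebble on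 every output. Its I/O cost $Q$ is the largest number of I/O operations performed by a single processor. *Claim.* Let $PM\ge N^2$ (the matrix fits into the collective memory). Every pebbling of the LU factorization cDAG with $P$ processors, each with $M$ pebbles, has $$Q\;\ge\;\frac{2N^3-6N^2+4N}{3P\sqrt M}+\frac{N(N-1)}{2P}.$$ Moreover, the right-hand side equals $\frac{2N^3}{3P\sqrt M}+\mathcal O\!\left(\frac{N^2}{P}\right)$, with an absolute implied constant for all $N\ge 0$ and $P,M\ge 1$. -/

import Mathlib

/-! ## Computational DAGs and the parallel red-blue pebble game -/

/-- A computational directed graph: `edge u v` says that the value `u` is needed to compute `v`;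
`output` is the set of values that the computation has to deliver. -/
structure CDAG (V : Type*) where
  edge : V → V → Prop
  output : Set V

/-- Inputs are the vertices without incoming edges. -/
def CDAG.IsInput {V : Type*} (G : CDAG V) (v : V) : Prop :=
  ∀ u, ¬ G.edge u v

/-- A configuration of the game with `P` processors: `red p` is the set of vertices that carry a
pebble of the colour of processor `p` (its private fast memory), `blue` the set of vertices that
carry a blue pebble (slow memory). -/
@[ext]
structure PebbleConfig (P : ℕ) (V : Type*) where
  red : Fin P → Finset V
  blue : Finset V

/-- The moves of the game. -/
inductive PebbleMove (P : ℕ) (V : Type*) where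
  | compute (p : Fin P) (v : V)
  | load (p : Fin P) (v : V)
  | store (p : Fin P) (v : V)
  | dropRed (p : Fin P) (v : V)
  | dropBlue (v : V)

namespace PebbleConfig

variable {P : ℕ} {V : Type*} [DecidableEq V]

/-- Precondition of a move. A non-input vertex can be computed by `p` if all its direct
predecessors carry pebbles of `p` (no sharing between processors). A vertex that carries any
pebble at all, blue or of any processor, can receive a pebble of `p`. A vertex that carries a
pebble of `p` can be stored by `p`. Pebbles can be removed at any time. -/
def Allowed (G : CDAG V) (c : PebbleConfig P V) : PebbleMove P V → Prop
  | .compute p v => ¬ G.IsInput v ∧ ∀ u, G.edge u v → u ∈ c.red p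
  | .load _ v => v ∈ c.blue ∨ ∃ q, v ∈ c.red q
  | .store p v => v ∈ c.red p
  | .dropRed _ _ => True
  | .dropBlue _ => True

/-- Effect of a move. -/
def apply (c : PebbleConfig P V) : PebbleMove P V → PebbleConfig P V
  | .compute p v => { c with red := Function.update c.red p (insert v (c.red p)) }
  | .load p v => { c with red := Function.update c.red p (insert v (c.red p)) }
  | .store _ v => { c with blue := insert v c.blue }
  | .dropRed p v => { c with red := Function.update c.red p ((c.red p).erase v) }
  | .dropBlue v => { c with blue := c.blue.erase v }

/-- `Run G M c ms c'`: the list of moves `ms` can be played from `c`, leads to `c'`, and after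
each move every processor has at most `M` pebbles on the graph. -/
inductive Run (G : CDAG V) (M : ℕ) :
    PebbleConfig P V → List (PebbleMove P V) → PebbleConfig P V → Prop
  | nil (c : PebbleConfig P V) : Run G M c [] c
  | cons (c c' : PebbleConfig P V) (m : PebbleMove P V) (ms : List (PebbleMove P V)) :
      Allowed G c m → (∀ p, ((apply c m).red p).card ≤ M) → Run G M (apply c m) ms c' →
      Run G M c (m :: ms) c'

end PebbleConfig

/-- A pebbling: a sequence of moves that starts with blue pebbles on exactly the inputs and no
other pebbles, and ends with blue pebbles on all outputs. Recomputation is allowed. -/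
def CDAG.IsPebbling {V : Type*} [DecidableEq V] (G : CDAG V) (P M : ℕ)
    (ms : List (PebbleMove P V)) : Prop :=
  ∃ c c' : PebbleConfig P V,
    (∀ p, c.red p = ∅) ∧ (∀ v, v ∈ c.blue ↔ G.IsInput v) ∧
    PebbleConfig.Run G M c ms c' ∧ ∀ v ∈ G.output, v ∈ c'.blue

/-- The move is an I/O operation of processor `p`. A transfer between two processors is counted
for the receiving one only. -/
def PebbleMove.isIO {P : ℕ} {V : Type*} (p : Fin P) : PebbleMove P V → Bool
  | .load q _ => decide (q = p)
  | .store q _ => decide (q = p)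
  | _ => false

/-- The I/O cost of a pebbling: the largest number of I/O operations of one processor. -/
def pebblingIO {P : ℕ} {V : Type*} (ms : List (PebbleMove P V)) : ℕ :=
  Finset.univ.sup fun p : Fin P => ms.countP (PebbleMove.isIO p)

/-! ## The cDAG of in-place LU factorization without pivoting

    for k = 0, ..., N-1
      for i = k+1, ..., N-1
        S1:  A[i,k] := A[i,k] / A[k,k]
      for i = k+1, ..., N-1, for j = k+1, ..., N-1
        S2:  A[i,j] := A[i,j] - A[i,k] * A[k,j]
-/

/-- The number of times that the element `A[i,j]` is updated by the program. -/
def luLast (i j : ℕ) : ℕ := if j < i then j + 1 else i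

/-- A vertex: the element `A[row,col]` after `ver` updates. -/
@[ext]
structure LUVertex (N : ℕ) where
  row : Fin N
  col : Fin N
  ver : ℕ
  ver_le : ver ≤ luLast row col
deriving DecidableEq

/-- `v` is the element `A[i,j]` after `t` updates. -/
def LUVertex.Is {N : ℕ} (v : LUVertex N) (i j : Fin N) (t : ℕ) : Prop :=
  v.row = i ∧ v.col = j ∧ v.ver = t

/-- Data dependencies. In iteration `k`, an element that is being updated has been updated `k`
times before, `A[i,k]` with `k < i` is read by S2 after its update by S1, and `A[k,j]` with
`k ≤ j` has been updated `k` times. -/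
def luEdge {N : ℕ} (u v : LUVertex N) : Prop :=
  (∃ k i : Fin N, k < i ∧ v.Is i k (k + 1) ∧ (u.Is i k k ∨ u.Is k k k)) ∨
  (∃ k i j : Fin N, k < i ∧ k < j ∧ v.Is i j (k + 1) ∧
    (u.Is i j k ∨ u.Is i k (k + 1) ∨ u.Is k j k))

/-- The LU factorization cDAG. The delivered values are the last versions of all elements of the
array: the entries of the two triangular factors. -/
def luCDAG (N : ℕ) : CDAG (LUVertex N) where
  edge := luEdge
  output := {v | v.ver = luLast v.row v.col}

/-- The lower bound `(2N³ - 6N² + 4N) / (3P√M) + N(N-1) / (2P)`. -/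
noncomputable def luBound (N P M : ℕ) : ℝ :=
  (2 * (N : ℝ) ^ 3 - 6 * (N : ℝ) ^ 2 + 4 * (N : ℝ)) / (3 * (P : ℝ) * Real.sqrt (M : ℝ)) +
    (N : ℝ) * ((N : ℝ) - 1) / (2 * (P : ℝ))

/-! Only the S2 updates `(i, j, k)` with `k < i, j` are counted as work. The updates that one
processor performs in a time window project onto the updated elements `(i, j)` and the operands `(i,
k)` and `(k, j)`. Loomis-Whitney and AM-GM bound their number by the sum of the sizes of the three
projections (`sq_card_updates_le`), and that sum has to be bounded by the pebbles present at the
start plus the events in the window.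

The obstacle is an element that is both updated and used as an operand in the same window, perhaps
after a single load. Operands are always last versions, so such an element is finished inside the
window, and finishing it is charged as an extra event. With recomputation an element may be finished
many times; a `Schedule` therefore selects one computation of each last version, deriving it from
the earliest possible loaded version and, among these, at the earliest time. Versions above that
base are credited to the chain leading to this computation. Then `two_le_supply` shows that a doubly
used element is always paid for twice, which gives `card_projections_le`.

Events are thus loads and selected final computations. A window of `2M` events starting with at most
`M` pebbles contains at most `M√M` updates, so an update costs `2/√M` events
(`two_mul_card_updates_le`). There are at most `N(N-1)` final computations, one for each element
outside the first row; each such element is also stored, so in the sum over all processors the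
stores make up for them. The extra `N(N-1)/2` comes from the memories being empty at the start, in
`sum_add_half_le_card_mul`; this is where `PM ≥ N²` enters. -/

/-! ## Traces of runs -/

namespace PebbleConfig

variable {P : ℕ} {V : Type*} [DecidableEq V]

/-- The configuration after the first `t` moves. -/
def confAt (c : PebbleConfig P V) (ms : List (PebbleMove P V)) (t : ℕ) : PebbleConfig P V :=
  (ms.take t).foldl apply c

theorem confAt_succ {c : PebbleConfig P V} {ms : List (PebbleMove P V)} {t : ℕ}
    {m : PebbleMove P V} (h : ms[t]? = some m) :
    confAt c ms (t + 1) = apply (confAt c ms t) m := by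
  simp [confAt, List.take_add_one, h]

theorem confAt_succ_of_none {c : PebbleConfig P V} {ms : List (PebbleMove P V)} {t : ℕ}
    (h : ms[t]? = none) : confAt c ms (t + 1) = confAt c ms t := by
  simp [confAt, List.take_add_one, h]

theorem Run.allowed {G : CDAG V} {M : ℕ} {c c' : PebbleConfig P V} {ms : List (PebbleMove P V)}
    (h : Run G M c ms c') : ∀ (t : ℕ) (m : PebbleMove P V), ms[t]? = some m →
      Allowed G (confAt c ms t) m ∧ ∀ p, ((confAt c ms (t + 1)).red p).card ≤ M := by
  induction h with
  | nil c => simp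
  | cons c c' m ms ha hM _ ih =>
    intro t m' hm
    cases t with
    | zero =>
      obtain rfl : m = m' := by simpa using hm
      exact ⟨ha, hM⟩
    | succ t => exact ih t m' (by simpa using hm)

theorem Run.confAt_length {G : CDAG V} {M : ℕ} {c c' : PebbleConfig P V}
    {ms : List (PebbleMove P V)} (h : Run G M c ms c') : confAt c ms ms.length = c' := by
  induction h with
  | nil c => rfl
  | cons c c' m ms _ _ _ ih => simpa [confAt] using ih

theorem Run.card_red_le {G : CDAG V} {M : ℕ} {c c' : PebbleConfig P V}
    {ms : List (PebbleMove P V)} (h : Run G M c ms c') (h0 : ∀ p, c.red p = ∅) (p : Fin P)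
    (t : ℕ) : ((confAt c ms t).red p).card ≤ M := by
  induction t with
  | zero => simp [confAt, h0]
  | succ t ih =>
    rcases hm : ms[t]? with _ | m
    · rwa [confAt_succ_of_none hm]
    · exact (h.allowed t m hm).2 p

theorem mem_red_apply {c : PebbleConfig P V} {m : PebbleMove P V} {p : Fin P} {v : V}
    (h : v ∈ (apply c m).red p) : v ∈ c.red p ∨ m = .load p v ∨ m = .compute p v := by
  cases m with
  | compute q w =>
    by_cases hq : p = q
    · subst hq
      simp only [apply, Function.update_self, Finset.mem_insert] at h
      rcases h with rfl | h <;> simp [*]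
    · simp only [apply, Function.update_of_ne hq] at h
      exact .inl h
  | load q w =>
    by_cases hq : p = q
    · subst hq
      simp only [apply, Function.update_self, Finset.mem_insert] at h
      rcases h with rfl | h <;> simp [*]
    · simp only [apply, Function.update_of_ne hq] at h
      exact .inl h
  | store q w => exact .inl h
  | dropRed q w =>
    by_cases hq : p = q
    · subst hq
      simp only [apply, Function.update_self] at h
      exact .inl (Finset.mem_of_mem_erase h)
    · simp only [apply, Function.update_of_ne hq] at h
      exact .inl h
  | dropBlue w => exact .inl h

theorem mem_blue_apply {c : PebbleConfig P V} {m : PebbleMove P V} {v : V}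
    (h : v ∈ (apply c m).blue) : v ∈ c.blue ∨ ∃ p, m = .store p v := by
  cases m with
  | store q w =>
    simp only [apply, Finset.mem_insert] at h
    rcases h with rfl | h <;> simp [*]
  | dropBlue w => exact .inl (Finset.mem_of_mem_erase h)
  | _ => exact .inl h

theorem mem_red_confAt_succ {c : PebbleConfig P V} {ms : List (PebbleMove P V)} {p : Fin P}
    {t : ℕ} {v : V} (h : v ∈ (confAt c ms (t + 1)).red p) :
    v ∈ (confAt c ms t).red p ∨ ms[t]? = some (.load p v) ∨ ms[t]? = some (.compute p v) := by
  rcases hm : ms[t]? with _ | m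
  · rw [confAt_succ_of_none hm] at h
    exact .inl h
  · rw [confAt_succ hm] at h
    simpa using mem_red_apply h

theorem mem_blue_confAt_succ {c : PebbleConfig P V} {ms : List (PebbleMove P V)}
    {t : ℕ} {v : V} (h : v ∈ (confAt c ms (t + 1)).blue) :
    v ∈ (confAt c ms t).blue ∨ ∃ p, ms[t]? = some (.store p v) := by
  rcases hm : ms[t]? with _ | m
  · rw [confAt_succ_of_none hm] at h
    exact .inl h
  · rw [confAt_succ hm] at h
    simpa using mem_blue_apply h

/-- A vertex that is not blue at the beginning and carries a pebble later has been computed. -/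
theorem Run.exists_compute {G : CDAG V} {M : ℕ} {c c' : PebbleConfig P V}
    {ms : List (PebbleMove P V)} (h : Run G M c ms c') (h0 : ∀ p, c.red p = ∅) {v : V}
    (hv : v ∉ c.blue) (t : ℕ)
    (ht : v ∈ (confAt c ms t).blue ∨ ∃ p, v ∈ (confAt c ms t).red p) :
    ∃ (p : Fin P) (t' : ℕ), ms[t']? = some (.compute p v) := by
  induction t with
  | zero => simp [confAt, h0, hv] at ht
  | succ t ih =>
    rcases ht with ht | ⟨p, ht⟩
    · rcases mem_blue_confAt_succ ht with ht | ⟨p, hp⟩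
      · exact ih (.inl ht)
      · exact ih (.inr ⟨p, (h.allowed t _ hp).1⟩)
    · rcases mem_red_confAt_succ ht with ht | hp | hp
      · exact ih (.inr ⟨p, ht⟩)
      · exact ih (h.allowed t _ hp).1
      · exact ⟨p, t, hp⟩

theorem Run.exists_store {c : PebbleConfig P V} {ms : List (PebbleMove P V)} {v : V}
    (hv : v ∉ c.blue) (t : ℕ) (ht : v ∈ (confAt c ms t).blue) :
    ∃ (p : Fin P) (t' : ℕ), ms[t']? = some (.store p v) := by
  induction t with
  | zero => exact absurd ht hv
  | succ t ih =>
    rcases mem_blue_confAt_succ ht with ht | ⟨p, hp⟩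
    · exact ih ht
    · exact ⟨p, t, hp⟩

end PebbleConfig

/-! ## The LU cDAG -/

namespace LUVertex

variable {N : ℕ}

/-- The array element of which the vertex is a version. -/
def pos (v : LUVertex N) : Fin N × Fin N := (v.row, v.col)

/-- The preceding version of the same element (the vertex itself if there is none). -/
def pred (v : LUVertex N) : LUVertex N := ⟨v.row, v.col, v.ver - 1, (Nat.sub_le _ _).trans v.ver_le⟩

/-- The last version of an element. -/
def last (q : Fin N × Fin N) : LUVertex N := ⟨q.1, q.2, luLast q.1 q.2, le_rfl⟩

@[simp] theorem pos_pred (v : LUVertex N) : v.pred.pos = v.pos := rfl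
@[simp] theorem ver_pred (v : LUVertex N) : v.pred.ver = v.ver - 1 := rfl
@[simp] theorem pos_last (q : Fin N × Fin N) : (last q).pos = q := rfl
@[simp] theorem ver_last (q : Fin N × Fin N) : (last q).ver = luLast q.1 q.2 := rfl

theorem eq_of_pos_ver {u v : LUVertex N} (hp : u.pos = v.pos) (hv : u.ver = v.ver) : u = v := by
  simp only [pos, Prod.mk.injEq] at hp
  exact LUVertex.ext hp.1 hp.2 hv

theorem ver_le_last (v : LUVertex N) : v.ver ≤ (last v.pos).ver := v.ver_le

theorem one_le_luLast {i j : ℕ} (hi : i ≠ 0) : 1 ≤ luLast i j := by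
  unfold luLast; split <;> omega

/-- The value of `A[i,j]` after iteration `k`, for a triple `(i, j, k)` with `k < i` and
`k < j`. -/
def update (x : Fin N × Fin N × Fin N) (h : x.2.2 < x.1 ∧ x.2.2 < x.2.1) : LUVertex N :=
  ⟨x.1, x.2.1, x.2.2 + 1, by
    have h1 : (x.2.2 : ℕ) < x.1 := h.1
    have h2 : (x.2.2 : ℕ) < x.2.1 := h.2
    unfold luLast; split <;> omega⟩

theorem luEdge_pred {v : LUVertex N} (hv : 1 ≤ v.ver) : luEdge v.pred v := by
  obtain ⟨i, j, t, ht⟩ := v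
  simp only at hv
  have hi := i.2
  have hj := j.2
  obtain ⟨k, rfl⟩ : ∃ k, t = k + 1 := ⟨t - 1, by omega⟩
  unfold luLast at ht
  by_cases hji : (j : ℕ) < i
  · rw [if_pos hji] at ht
    by_cases hk : k = j
    · subst hk
      exact .inl ⟨j, i, hji, ⟨rfl, rfl, rfl⟩, .inl ⟨rfl, rfl, rfl⟩⟩
    · refine .inr ⟨⟨k, by omega⟩, i, j, ?_, ?_, ⟨rfl, rfl, rfl⟩, .inl ⟨rfl, rfl, rfl⟩⟩ <;>
        simp only [Fin.lt_def] <;> omega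
  · rw [if_neg hji] at ht
    refine .inr ⟨⟨k, by omega⟩, i, j, ?_, ?_, ⟨rfl, rfl, rfl⟩, .inl ⟨rfl, rfl, rfl⟩⟩ <;>
      simp only [Fin.lt_def] <;> omega

theorem isInput_iff (v : LUVertex N) : (luCDAG N).IsInput v ↔ v.ver = 0 := by
  constructor
  · intro h
    by_contra hv
    exact h _ (luEdge_pred (Nat.one_le_iff_ne_zero.2 hv))
  · rintro hv u (⟨k, i, -, ⟨-, -, h⟩, -⟩ | ⟨k, i, j, -, -, ⟨-, -, h⟩, -⟩) <;> omega

/-- An operand of S2 is never updated again: `A[i,k]` with `k < i` is final after its division in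
iteration `k`, and `A[k,j]` with `k < j` after the `k` preceding iterations. The argument for two
copies in `two_le_supply` depends on this. -/
theorem luEdge_update_left (x : Fin N × Fin N × Fin N) (h : x.2.2 < x.1 ∧ x.2.2 < x.2.1) :
    luEdge (last (x.1, x.2.2)) (update x h) := by
  refine .inr ⟨x.2.2, x.1, x.2.1, h.1, h.2, ⟨rfl, rfl, rfl⟩, .inr (.inl ⟨rfl, rfl, ?_⟩)⟩
  exact if_pos h.1

theorem luEdge_update_right (x : Fin N × Fin N × Fin N) (h : x.2.2 < x.1 ∧ x.2.2 < x.2.1) :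
    luEdge (last (x.2.2, x.2.1)) (update x h) := by
  refine .inr ⟨x.2.2, x.1, x.2.1, h.1, h.2, ⟨rfl, rfl, rfl⟩, .inr (.inr ⟨rfl, rfl, ?_⟩)⟩
  exact if_neg (not_lt.2 h.2.le)

end LUVertex

/-! ## Traces of LU pebblings -/

/-- What the lower bound uses of a pebbling: the red pebbles at each time and the moves. -/
structure LUTrace (P N M : ℕ) where
  red : Fin P → ℕ → Finset (LUVertex N)
  move : ℕ → Option (PebbleMove P (LUVertex N))
  length : ℕ
  lt_length : ∀ {t m}, move t = some m → t < length
  red_zero : ∀ p, red p 0 = ∅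
  card_red_le : ∀ p t, (red p t).card ≤ M
  of_mem_red_succ : ∀ {p t v}, v ∈ red p (t + 1) →
    v ∈ red p t ∨ move t = some (.load p v) ∨ move t = some (.compute p v)
  ver_of_compute : ∀ {p t v}, move t = some (.compute p v) → 1 ≤ v.ver
  mem_of_compute : ∀ {p t u v}, move t = some (.compute p v) → luEdge u v → u ∈ red p t
  mem_of_store : ∀ {p t v}, move t = some (.store p v) → v ∈ red p t
  exists_compute : ∀ v, 1 ≤ v.ver → ∃ p t, move t = some (.compute p v)
  exists_store : ∀ q : Fin N × Fin N, (q.1 : ℕ) ≠ 0 →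
    ∃ p t, move t = some (.store p (LUVertex.last q))

/-- The point is that every updated version is computed at some time: the last version ends up blue,
and whenever a version is computed, the preceding one carries a pebble. `hcomp` descends through the
versions in this way. -/
theorem CDAG.IsPebbling.exists_trace {P N M : ℕ} {ms : List (PebbleMove P (LUVertex N))}
    (h : (luCDAG N).IsPebbling P M ms) :
    ∃ T : LUTrace P N M, T.length = ms.length ∧ ∀ t, T.move t = ms[t]? := by
  obtain ⟨c, c', h0, hblue, hrun, hout⟩ := h
  have hb : ∀ v : LUVertex N, 1 ≤ v.ver → v ∉ c.blue := fun v hv hvb => by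
    have := (LUVertex.isInput_iff v).1 ((hblue v).1 hvb)
    omega
  have hver : ∀ {p : Fin P} {t : ℕ} {v : LUVertex N}, ms[t]? = some (.compute p v) → 1 ≤ v.ver := by
    intro p t v hm
    have := (hrun.allowed t _ hm).1.1
    rw [LUVertex.isInput_iff] at this
    omega
  have hlast : ∀ q : Fin N × Fin N,
      LUVertex.last q ∈ (PebbleConfig.confAt c ms ms.length).blue := by
    intro q
    rw [hrun.confAt_length]
    exact hout _ rfl
  have hcomp : ∀ (d : ℕ) (v : LUVertex N), 1 ≤ v.ver → v.ver + d = (LUVertex.last v.pos).ver →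
      ∃ (p : Fin P) (t : ℕ), ms[t]? = some (.compute p v) := by
    intro d
    induction d with
    | zero =>
      intro v hv hd
      have : v = LUVertex.last v.pos := LUVertex.eq_of_pos_ver rfl hd
      refine hrun.exists_compute h0 (hb v hv) ms.length (.inl ?_)
      rw [this]
      exact hlast _
    | succ d ih =>
      intro v hv hd
      let w : LUVertex N := ⟨v.row, v.col, v.ver + 1, by
        change v.ver + (d + 1) = luLast v.row v.col at hd
        omega⟩
      obtain ⟨p, t, hw⟩ := ih w (by simp [w]) (by
        change v.ver + (d + 1) = luLast v.row v.col at hd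
        change v.ver + 1 + d = luLast v.row v.col
        omega)
      have hmem : w.pred ∈ (PebbleConfig.confAt c ms t).red p :=
        (hrun.allowed t _ hw).1.2 _ (LUVertex.luEdge_pred (hver hw))
      exact hrun.exists_compute h0 (hb v hv) t (.inr ⟨p, hmem⟩)
  refine ⟨{
    red := fun p t => (PebbleConfig.confAt c ms t).red p
    move := fun t => ms[t]?
    length := ms.length
    lt_length := fun h => (List.getElem?_eq_some_iff.1 h).1
    red_zero := h0
    card_red_le := hrun.card_red_le h0
    of_mem_red_succ := PebbleConfig.mem_red_confAt_succ
    ver_of_compute := hver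
    mem_of_compute := fun hm he => (hrun.allowed _ _ hm).1.2 _ he
    mem_of_store := fun hm => (hrun.allowed _ _ hm).1
    exists_compute := fun v hv => hcomp _ v hv (Nat.add_sub_of_le v.ver_le_last)
    exists_store := fun q hq => PebbleConfig.Run.exists_store
      (hb _ (LUVertex.one_le_luLast hq)) _ (hlast q) }, rfl, fun _ => rfl⟩

namespace LUVertex

theorem row_ne_zero {N : ℕ} {v : LUVertex N} (hv : 1 ≤ v.ver) : (v.pos.1 : ℕ) ≠ 0 := by
  intro h
  have hle := v.ver_le
  change (v.row : ℕ) = 0 at h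
  simp [luLast, h] at hle
  omega

end LUVertex

/-! ## Assigning the updates to processors -/

namespace LUTrace

open LUVertex Finset

open scoped Classical in
/-- The version of its element from which processor `p` has derived its copy of `v` at time `t`:
the version that it last loaded before it arrived at `v` by computations. -/
noncomputable def base {P N M : ℕ} (T : LUTrace P N M) (p : Fin P) : ℕ → LUVertex N → ℕ
  | 0, v => v.ver
  | t + 1, v =>
    if v ∈ T.red p t then T.base p t v
    else if T.move t = some (.load p v) then v.ver
    else T.base p t v.pred

variable {P N M : ℕ} {T : LUTrace P N M}

theorem pred_mem_of_compute {p : Fin P} {t : ℕ} {v : LUVertex N}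
    (h : T.move t = some (.compute p v)) : v.pred ∈ T.red p t :=
  T.mem_of_compute h (luEdge_pred (T.ver_of_compute h))

/-- All versions after the base have been computed by the processor. -/
theorem exists_compute_of_base_lt {p : Fin P} {u : ℕ} :
    ∀ {v w : LUVertex N}, v ∈ T.red p u → w.pos = v.pos → T.base p u v < w.ver → w.ver ≤ v.ver →
      ∃ t < u, T.move t = some (.compute p w) ∧ T.base p t w.pred = T.base p u v := by
  induction u with
  | zero => intro v w hv; simp [T.red_zero] at hv
  | succ u ih =>
    intro v w hv hpos hlt hle
    by_cases hvu : v ∈ T.red p u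
    · have hb : T.base p (u + 1) v = T.base p u v := by simp [base, hvu]
      rw [hb] at hlt ⊢
      obtain ⟨t, ht, h⟩ := ih hvu hpos hlt hle
      exact ⟨t, by omega, h⟩
    · by_cases hl : T.move u = some (.load p v)
      · have hb : T.base p (u + 1) v = v.ver := by simp [base, hvu, hl]
        omega
      · have hb : T.base p (u + 1) v = T.base p u v.pred := by simp [base, hvu, hl]
        rw [hb] at hlt ⊢
        have hc : T.move u = some (.compute p v) := by
          rcases T.of_mem_red_succ hv with h | h | h
          · exact absurd h hvu
          · exact absurd h hl
          · exact h
        rcases hle.eq_or_lt with heq | hlt'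
        · obtain rfl := eq_of_pos_ver hpos heq
          exact ⟨u, by omega, hc, rfl⟩
        · obtain ⟨t, ht, h⟩ := ih (pred_mem_of_compute hc) (w := w) (by simpa using hpos) hlt
            (by simp only [ver_pred]; omega)
          exact ⟨t, by omega, h⟩

/-- An assignment of one computation to each updated vertex. Among the computations of the last
version of an element, `finalTime` is the first one of those with the smallest base, and the
versions after that base are assigned to the computations that lead to it. -/
structure Schedule (T : LUTrace P N M) where
  finalProc : Fin N × Fin N → Fin P
  finalTime : Fin N × Fin N → ℕ
  proc : LUVertex N → Fin P
  time : LUVertex N → ℕ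
  move_finalTime : ∀ q, (q.1 : ℕ) ≠ 0 →
    T.move (finalTime q) = some (.compute (finalProc q) (last q))
  base_min : ∀ q, (q.1 : ℕ) ≠ 0 → ∀ p t, T.move t = some (.compute p (last q)) →
    T.base (finalProc q) (finalTime q) (last q).pred ≤ T.base p t (last q).pred
  finalTime_min : ∀ q, (q.1 : ℕ) ≠ 0 → ∀ p t, T.move t = some (.compute p (last q)) →
    T.base p t (last q).pred ≤ T.base (finalProc q) (finalTime q) (last q).pred →
    finalTime q ≤ t
  move_time : ∀ v, 1 ≤ v.ver → T.move (time v) = some (.compute (proc v) v)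
  of_base_lt : ∀ v, 1 ≤ v.ver →
    T.base (finalProc v.pos) (finalTime v.pos) (last v.pos).pred < v.ver →
    proc v = finalProc v.pos ∧ time v ≤ finalTime v.pos ∧
    T.base (proc v) (time v) v.pred =
      T.base (finalProc v.pos) (finalTime v.pos) (last v.pos).pred

theorem exists_final_compute (T : LUTrace P N M) (q : Fin N × Fin N) (hq : (q.1 : ℕ) ≠ 0) :
    ∃ p t, T.move t = some (.compute p (last q)) ∧
      ∀ p' t', T.move t' = some (.compute p' (last q)) →
        T.base p t (last q).pred ≤ T.base p' t' (last q).pred ∧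
        (T.base p' t' (last q).pred ≤ T.base p t (last q).pred → t ≤ t') := by
  classical
  obtain ⟨p₀, t₀, h₀⟩ := T.exists_compute (last q) (one_le_luLast hq)
  -- Lexicographic minimum: first the smallest base, then the earliest time that attains it.
  have h1 : ∃ d p t, T.move t = some (.compute p (last q)) ∧ T.base p t (last q).pred = d :=
    ⟨_, p₀, t₀, h₀, rfl⟩
  have h2 : ∃ t p, T.move t = some (.compute p (last q)) ∧
      T.base p t (last q).pred = Nat.find h1 := by
    obtain ⟨p, t, h⟩ := Nat.find_spec h1
    exact ⟨t, p, h⟩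
  obtain ⟨p, hp, hb⟩ := Nat.find_spec h2
  refine ⟨p, Nat.find h2, hp, fun p' t' h' => ?_⟩
  have hle : Nat.find h1 ≤ T.base p' t' (last q).pred := Nat.find_min' h1 ⟨p', t', h', rfl⟩
  rw [hb]
  exact ⟨hle, fun hge => Nat.find_min' h2 ⟨p', h', le_antisymm hge hle⟩⟩

/-- Versions above the selected base come from the chain given by `exists_compute_of_base_lt`; the
others may go to any of their computations. Elements of the first row are never updated and get
dummy values. -/
theorem nonempty_schedule (T : LUTrace P N M) (hP : 0 < P) : Nonempty T.Schedule := by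
  classical
  have hf : ∀ q : Fin N × Fin N, ∃ p t, (q.1 : ℕ) ≠ 0 →
      T.move t = some (.compute p (last q)) ∧
      ∀ p' t', T.move t' = some (.compute p' (last q)) →
        T.base p t (last q).pred ≤ T.base p' t' (last q).pred ∧
        (T.base p' t' (last q).pred ≤ T.base p t (last q).pred → t ≤ t') := by
    intro q
    by_cases hq : (q.1 : ℕ) = 0
    · exact ⟨⟨0, hP⟩, 0, fun h => absurd hq h⟩
    · obtain ⟨p, t, h⟩ := T.exists_final_compute q hq
      exact ⟨p, t, fun _ => h⟩
  choose fp ft hfin using hf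
  have ha : ∀ v : LUVertex N, ∃ p t, 1 ≤ v.ver → T.move t = some (.compute p v) ∧
      (T.base (fp v.pos) (ft v.pos) (last v.pos).pred < v.ver →
        p = fp v.pos ∧ t ≤ ft v.pos ∧
        T.base p t v.pred = T.base (fp v.pos) (ft v.pos) (last v.pos).pred) := by
    intro v
    by_cases hv : 1 ≤ v.ver
    · have hm := (hfin v.pos (row_ne_zero hv)).1
      by_cases hb : T.base (fp v.pos) (ft v.pos) (last v.pos).pred < v.ver
      · rcases v.ver_le_last.eq_or_lt with heq | hlt
        · obtain h := eq_of_pos_ver (u := v) (v := last v.pos) rfl heq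
          refine ⟨fp v.pos, ft v.pos, fun _ => ⟨?_, fun _ => ⟨rfl, le_rfl, ?_⟩⟩⟩
          · rw [hm, ← h]
          · rw [← h]
        · obtain ⟨t, ht, h⟩ := exists_compute_of_base_lt (pred_mem_of_compute hm) (w := v) rfl hb
            (by rw [ver_pred]; omega)
          exact ⟨_, t, fun _ => ⟨h.1, fun _ => ⟨rfl, ht.le, h.2⟩⟩⟩
      · obtain ⟨p, t, h⟩ := T.exists_compute v hv
        exact ⟨p, t, fun _ => ⟨h, fun h' => absurd h' hb⟩⟩
    · exact ⟨⟨0, hP⟩, 0, fun h => absurd h hv⟩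
  choose ap at' hass using ha
  exact ⟨{
    finalProc := fp
    finalTime := ft
    proc := ap
    time := at'
    move_finalTime := fun q hq => (hfin q hq).1
    base_min := fun q hq p t h => ((hfin q hq).2 p t h).1
    finalTime_min := fun q hq p t h => ((hfin q hq).2 p t h).2
    move_time := fun v hv => (hass v hv).1
    of_base_lt := fun v hv => (hass v hv).2 }⟩

/-! ### Events and the copies they supply -/

namespace Schedule

variable (S : T.Schedule)

/-- At time `t`, processor `p` loads a version of the element `q`, or performs the computation
of its last version that the schedule selects. -/
def EventAt (p : Fin P) (t : ℕ) (q : Fin N × Fin N) : Prop :=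
  (∃ v : LUVertex N, v.pos = q ∧ T.move t = some (.load p v)) ∨
    ((q.1 : ℕ) ≠ 0 ∧ S.finalProc q = p ∧ S.finalTime q = t)

variable {S}

theorem EventAt.unique {p : Fin P} {t : ℕ} {q q' : Fin N × Fin N} (h : S.EventAt p t q)
    (h' : S.EventAt p t q') : q = q' := by
  rcases h with ⟨v, rfl, hv⟩ | ⟨hq, rfl, rfl⟩ <;> rcases h' with ⟨v', rfl, hv'⟩ | ⟨hq', hp, ht⟩
  · rw [hv] at hv'
    simp only [Option.some.injEq, PebbleMove.load.injEq] at hv'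
    rw [hv'.2]
  · have := S.move_finalTime _ hq'
    rw [ht, hv] at this
    simp at this
  · have := S.move_finalTime _ hq
    rw [hv'] at this
    simp at this
  · have h1 := S.move_finalTime _ hq
    have h2 := S.move_finalTime _ hq'
    rw [ht, h1] at h2
    simp only [Option.some.injEq, PebbleMove.compute.injEq] at h2
    simpa using congrArg pos h2.2

variable (S)

open scoped Classical in
/-- The number of copies of the element `q` that processor `p` is granted between `s` and `e`. -/
noncomputable def supply (p : Fin P) (s e : ℕ) (q : Fin N × Fin N) : ℕ :=
  #{v ∈ T.red p s | v.pos = q} + #{t ∈ Ico s e | S.EventAt p t q}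

variable {S}

/-- Computing a version requires the preceding version of the same element, so tracing a pebble back
in time ends at a load or at the start of the window. -/
theorem exists_copy {p : Fin P} {s u : ℕ} {v : LUVertex N} (hs : s ≤ u)
    (hv : v ∈ T.red p u) :
    (∃ w ∈ T.red p s, w.pos = v.pos) ∨
      ∃ t w, s ≤ t ∧ t < u ∧ T.move t = some (.load p w) ∧ w.pos = v.pos := by
  induction u, hs using Nat.le_induction generalizing v with
  | base => exact .inl ⟨v, hv, rfl⟩
  | succ u hsu ih =>
    have hstep : v ∈ T.red p u ∨ v.pred ∈ T.red p u ∨ T.move u = some (.load p v) := by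
      rcases T.of_mem_red_succ hv with h | h | h
      · exact .inl h
      · exact .inr (.inr h)
      · exact .inr (.inl (pred_mem_of_compute h))
    rcases hstep with h | h | h
    · rcases ih h with h | ⟨t, w, h1, h2, h3⟩
      · exact .inl h
      · exact .inr ⟨t, w, h1, by omega, h3⟩
    · rcases ih h with h | ⟨t, w, h1, h2, h3⟩
      · exact .inl h
      · exact .inr ⟨t, w, h1, by omega, h3⟩
    · exact .inr ⟨u, v, hsu, by omega, h, rfl⟩

theorem base_le_ver {p : Fin P} {t : ℕ} {v : LUVertex N} (hv : v ∈ T.red p t) :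
    T.base p t v ≤ v.ver := by
  induction t generalizing v with
  | zero => exact le_rfl
  | succ t ih =>
    rw [base]
    split_ifs with h1 h2
    · exact ih h1
    · exact le_rfl
    · rcases T.of_mem_red_succ hv with h | h | h
      · exact absurd h h1
      · exact absurd h h2
      · exact (ih (pred_mem_of_compute h)).trans (Nat.sub_le _ _)

/-- Computations preserve the base and raise the version. A load may reset the base to the loaded
version, hence the condition `β = d` on loads. -/
theorem base_eq_of_copies {p : Fin P} {s u : ℕ} {q : Fin N × Fin N} {β d : ℕ} (hs : s ≤ u)
    (hred : ∀ v ∈ T.red p s, v.pos = q → T.base p s v = β ∧ v.ver = d)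
    (hload : ∀ t v, s ≤ t → t < u → T.move t = some (.load p v) → v.pos = q →
      β = d ∧ v.ver = d) :
    ∀ v ∈ T.red p u, v.pos = q → T.base p u v = β ∧ d ≤ v.ver := by
  induction u, hs using Nat.le_induction with
  | base => exact fun v hv hq => ⟨(hred v hv hq).1, (hred v hv hq).2.ge⟩
  | succ u hsu ih =>
    intro v hv hq
    have ih := ih fun t v h1 h2 => hload t v h1 (by omega)
    rw [base]
    split_ifs with h1 h2
    · exact ih v h1 hq
    · obtain ⟨h3, h4⟩ := hload u v hsu (by omega) h2 hq
      omega
    · rcases T.of_mem_red_succ hv with h | h | h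
      · exact absurd h h1
      · exact absurd h h2
      · obtain ⟨h3, h4⟩ := ih _ (pred_mem_of_compute h) hq
        exact ⟨h3, h4.trans (Nat.sub_le _ _)⟩

theorem one_le_supply {p : Fin P} {s e u : ℕ} {v : LUVertex N} (hs : s ≤ u) (hu : u ≤ e)
    (hv : v ∈ T.red p u) : 1 ≤ S.supply p s e v.pos := by
  classical
  unfold supply
  rcases exists_copy hs hv with ⟨w, hw, hq⟩ | ⟨t, w, h1, h2, h3, hq⟩
  · have : 0 < #{x ∈ T.red p s | x.pos = v.pos} := card_pos.2 ⟨w, mem_filter.2 ⟨hw, hq⟩⟩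
    omega
  · have : 0 < #{t ∈ Ico s e | S.EventAt p t v.pos} :=
      card_pos.2 ⟨t, mem_filter.2 ⟨mem_Ico.2 ⟨h1, by omega⟩, .inl ⟨w, hq, h3⟩⟩⟩
    omega

/-- If only one copy of an element is supplied, all versions are derived from it. -/
theorem exists_base_eq {p : Fin P} {s e : ℕ} {q : Fin N × Fin N} (h : S.supply p s e q ≤ 1) :
    ∃ β d, β ≤ d ∧ (∀ v ∈ T.red p s, v.pos = q → v.ver = d) ∧
      (∀ t v, s ≤ t → t < e → T.move t = some (.load p v) → v.pos = q → v.ver = d) ∧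
      ∀ u, s ≤ u → u ≤ e → ∀ v ∈ T.red p u, v.pos = q → T.base p u v = β ∧ d ≤ v.ver := by
  classical
  suffices ∃ β d, β ≤ d ∧ (∀ v ∈ T.red p s, v.pos = q → T.base p s v = β ∧ v.ver = d) ∧
      (∀ t v, s ≤ t → t < e → T.move t = some (.load p v) → v.pos = q → β = d ∧ v.ver = d) by
    obtain ⟨β, d, hβ, h1, h2⟩ := this
    exact ⟨β, d, hβ, fun v hv hq => (h1 v hv hq).2,
      fun t v ht ht' hl hq => (h2 t v ht ht' hl hq).2,
      fun u hsu hue => base_eq_of_copies hsu h1 fun t v ht ht' => h2 t v ht (by omega)⟩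
  unfold supply at h
  by_cases hr : ∃ w ∈ T.red p s, w.pos = q
  · obtain ⟨w, hw, hq⟩ := hr
    have hw' : w ∈ ({x ∈ T.red p s | x.pos = q} : Finset _) := mem_filter.2 ⟨hw, hq⟩
    have h1 : 0 < #{x ∈ T.red p s | x.pos = q} := card_pos.2 ⟨w, hw'⟩
    refine ⟨T.base p s w, w.ver, base_le_ver hw, fun v hv hvq => ?_, fun t v ht ht' hl hvq => ?_⟩
    · rw [card_le_one.1 (by omega : #{x ∈ T.red p s | x.pos = q} ≤ 1) v
        (mem_filter.2 ⟨hv, hvq⟩) w hw']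
      exact ⟨rfl, rfl⟩
    · have : 0 < #{t ∈ Ico s e | S.EventAt p t q} :=
        card_pos.2 ⟨t, mem_filter.2 ⟨mem_Ico.2 ⟨ht, ht'⟩, .inl ⟨v, hvq, hl⟩⟩⟩
      omega
  · push Not at hr
    by_cases hl : ∃ t w, s ≤ t ∧ t < e ∧ T.move t = some (.load p w) ∧ w.pos = q
    · obtain ⟨t, w, h1, h2, h3, hq⟩ := hl
      refine ⟨w.ver, w.ver, le_rfl, fun v hv hvq => absurd hvq (hr v hv),
        fun t' v ht ht' hl hvq => ⟨rfl, ?_⟩⟩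
      have htt : t' = t := card_le_one.1 (by omega : #{t ∈ Ico s e | S.EventAt p t q} ≤ 1) t'
        (mem_filter.2 ⟨mem_Ico.2 ⟨ht, ht'⟩, .inl ⟨v, hvq, hl⟩⟩) t
        (mem_filter.2 ⟨mem_Ico.2 ⟨h1, h2⟩, .inl ⟨w, hq, h3⟩⟩)
      rw [htt, h3] at hl
      simp only [Option.some.injEq, PebbleMove.load.injEq] at hl
      rw [hl.2]
    · push Not at hl
      exact ⟨0, 0, le_rfl, fun v hv hvq => absurd hvq (hr v hv),
        fun t v ht ht' h hvq => absurd hvq (hl t v ht ht' h)⟩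

/-- An element that is updated and whose last version is used needs two copies. -/
theorem two_le_supply {p : Fin P} {s e u : ℕ} {v : LUVertex N} (hv : 1 ≤ v.ver)
    (hp : S.proc v = p) (hs : s ≤ S.time v) (he : S.time v < e) (hsu : s ≤ u) (hu : u < e)
    (hlast : last v.pos ∈ T.red p u) : 2 ≤ S.supply p s e v.pos := by
  classical
  by_contra! hlt
  subst hp
  have hrow := row_ne_zero hv
  obtain ⟨β, d, hβd, hred, hload, hbase⟩ := exists_base_eq (S := S) (Nat.le_of_lt_succ hlt)
  have hm := S.move_time v hv
  obtain ⟨hβ, hdv⟩ := hbase _ hs he.le _ (pred_mem_of_compute hm) (pos_pred v)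
  rw [ver_pred] at hdv
  -- The only copy supplied has version `d`, which is below `v.ver`. So the last version is not that
  -- copy and was computed inside the window.
  have hcomp : ∀ w, s ≤ w → w ≤ u → last v.pos ∈ T.red (S.proc v) w →
      ∃ t, s ≤ t ∧ t < w ∧ T.move t = some (.compute (S.proc v) (last v.pos)) := by
    intro w hw
    have hd : (last v.pos).ver ≠ d := by have := v.ver_le_last; omega
    induction w, hw using Nat.le_induction with
    | base => exact fun _ h => absurd (hred _ h rfl) hd
    | succ w hsw ih =>
      intro hwu h
      rcases T.of_mem_red_succ h with h | h | h
      · obtain ⟨t, h1, h2, h3⟩ := ih (by omega) h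
        exact ⟨t, h1, by omega, h3⟩
      · exact absurd (hload w _ hsw (by omega) h rfl) hd
      · exact ⟨w, hsw, by omega, h⟩
  obtain ⟨t, hst, htu, ht⟩ := hcomp u hsu le_rfl hlast
  have htβ := (hbase t hst (by omega) _ (pred_mem_of_compute ht) rfl).1
  have hmin := S.base_min _ hrow _ _ ht
  rw [htβ] at hmin
  -- The smallest base is at most `β ≤ d < v.ver`, so `v` lies on the selected chain and the
  -- smallest base equals `β`. The selected final computation then falls between `S.time v` and `t`,
  -- hence in the window.
  obtain ⟨h1, h2, h3⟩ := S.of_base_lt v hv (by omega)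
  have hle := S.finalTime_min _ hrow _ _ ht (by rw [htβ, ← h3, hβ])
  have hev : S.finalTime v.pos ∈ ({t ∈ Ico s e | S.EventAt (S.proc v) t v.pos} : Finset ℕ) :=
    mem_filter.2 ⟨mem_Ico.2 ⟨by omega, by omega⟩, .inr ⟨hrow, h1.symm, rfl⟩⟩
  have hev' := card_pos.2 ⟨_, hev⟩
  unfold supply at hlt
  -- The copy from which `v` was derived is a second item of supply: a load cannot coincide with the
  -- selected computation.
  rcases exists_copy hs (pred_mem_of_compute hm) with ⟨w, hw, hq⟩ | ⟨t', w, h4, h5, h6, hq⟩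
  · have : 0 < #{x ∈ T.red (S.proc v) s | x.pos = v.pos} :=
      card_pos.2 ⟨w, mem_filter.2 ⟨hw, hq⟩⟩
    omega
  · have htt := card_le_one.1
      (by omega : #{t ∈ Ico s e | S.EventAt (S.proc v) t v.pos} ≤ 1) t'
      (mem_filter.2 ⟨mem_Ico.2 ⟨h4, by omega⟩, .inl ⟨w, hq, h6⟩⟩) _ hev
    have := S.move_finalTime _ hrow
    rw [← htt, h6] at this
    simp at this

end Schedule

end LUTrace

/-! ## The discrete Loomis-Whitney inequality -/

/-- Cauchy-Schwarz over the fibres of the first projection: a pair of points in one fibre is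
determined by the second projection of one point and the third projection of the other. -/
theorem Finset.sq_card_le_card_mul_card_mul_card {α β γ : Type*} [DecidableEq α] [DecidableEq β]
    [DecidableEq γ] (H : Finset (α × β × γ)) :
    H.card ^ 2 ≤ (H.image fun x => (x.1, x.2.1)).card *
      ((H.image fun x => (x.1, x.2.2)).card * (H.image fun x => (x.2.2, x.2.1)).card) := by
  set A := H.image fun x => (x.1, x.2.1) with hA
  have hcard : H.card = ∑ q ∈ A, (H.filter fun x => (x.1, x.2.1) = q).card :=
    Finset.card_eq_sum_card_image _ _
  have hpairs : ∑ q ∈ A, (H.filter fun x => (x.1, x.2.1) = q).card ^ 2 ≤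
      (H.image fun x => (x.1, x.2.2)).card * (H.image fun x => (x.2.2, x.2.1)).card := by
    rw [← Finset.card_product]
    calc ∑ q ∈ A, (H.filter fun x => (x.1, x.2.1) = q).card ^ 2
        = (A.sigma fun q => (H.filter fun x => (x.1, x.2.1) = q) ×ˢ
            (H.filter fun x => (x.1, x.2.1) = q)).card := by
          simp [Finset.card_sigma, Finset.card_product, sq]
      _ ≤ _ := by
          refine Finset.card_le_card_of_injOn
            (fun z => ((z.2.1.1, z.2.1.2.2), (z.2.2.2.2, z.2.2.2.1))) ?_ ?_
          · rintro ⟨q, x, y⟩ hz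
            simp only [Finset.coe_sigma, Set.mem_sigma_iff, Finset.mem_coe, Finset.mem_product,
              Finset.mem_filter] at hz
            simp only [Finset.mem_coe, Finset.mem_product, Finset.mem_image]
            exact ⟨⟨x, hz.2.1.1, rfl⟩, ⟨y, hz.2.2.1, rfl⟩⟩
          · rintro ⟨q, x, y⟩ hz ⟨q', x', y'⟩ hz' heq
            simp only [Finset.coe_sigma, Set.mem_sigma_iff, Finset.mem_coe, Finset.mem_product,
              Finset.mem_filter] at hz hz'
            obtain ⟨x1, x2, x3⟩ := x
            obtain ⟨y1, y2, y3⟩ := y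
            obtain ⟨x1', x2', x3'⟩ := x'
            obtain ⟨y1', y2', y3'⟩ := y'
            obtain ⟨q1, q2⟩ := q
            obtain ⟨q1', q2'⟩ := q'
            simp only [Prod.mk.injEq] at hz hz' heq
            grind
  rw [hcard]
  exact sq_sum_le_card_mul_sum_sq.trans (Nat.mul_le_mul_left _ hpairs)

/-! ## The work of one processor -/

namespace LUTrace.Schedule

open LUVertex Finset

variable {P N M : ℕ} {T : LUTrace P N M} (S : T.Schedule)

open scoped Classical in
/-- The number of events of processor `p` between `s` and `e`. -/
noncomputable def events (p : Fin P) (s e : ℕ) : ℕ := #{t ∈ Ico s e | ∃ q, S.EventAt p t q}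

open scoped Classical in
/-- The updates that are assigned to computations of processor `p` between `s` and `e`. -/
noncomputable def updates (p : Fin P) (s e : ℕ) : Finset (Fin N × Fin N × Fin N) :=
  {x | ∃ h : x.2.2 < x.1 ∧ x.2.2 < x.2.1, S.proc (update x h) = p ∧
    s ≤ S.time (update x h) ∧ S.time (update x h) < e}

variable {S}

theorem sum_supply (p : Fin P) (s e : ℕ) :
    ∑ q, S.supply p s e q = (T.red p s).card + S.events p s e := by
  classical
  unfold supply events
  rw [sum_add_distrib]
  congr 1
  · exact (card_eq_sum_card_fiberwise fun _ _ => mem_univ _).symm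
  · rw [← card_biUnion]
    · congr 1
      ext t
      simp
    · intro q _ q' _ hq
      rw [Function.onFun, disjoint_left]
      intro t ht ht'
      exact hq ((mem_filter.1 ht).2.unique (mem_filter.1 ht').2)

/-- Compare element by element. The two operand projections lie strictly below and strictly above
the diagonal, so an element counts at most twice, and then it is both updated and used in its last
version: the case of `two_le_supply`. -/
theorem card_projections_le (p : Fin P) (s e : ℕ) :
    ((S.updates p s e).image fun x => (x.1, x.2.1)).card +
      (((S.updates p s e).image fun x => (x.1, x.2.2)).card +
        ((S.updates p s e).image fun x => (x.2.2, x.2.1)).card) ≤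
      (T.red p s).card + S.events p s e := by
  classical
  have hcard : ∀ A : Finset (Fin N × Fin N), A.card = ∑ q, if q ∈ A then 1 else 0 := by simp
  rw [← sum_supply, hcard, hcard, hcard, ← sum_add_distrib, ← sum_add_distrib]
  refine sum_le_sum fun q _ => ?_
  have hmem : ∀ x ∈ S.updates p s e, ∃ h : x.2.2 < x.1 ∧ x.2.2 < x.2.1,
      S.proc (update x h) = p ∧ s ≤ S.time (update x h) ∧ S.time (update x h) < e ∧
      T.move (S.time (update x h)) = some (.compute p (update x h)) := by
    intro x hx
    obtain ⟨h, h1, h2, h3⟩ := (mem_filter.1 hx).2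
    exact ⟨h, h1, h2, h3, by rw [← h1]; exact S.move_time _ (Nat.le_add_left _ _)⟩
  have hB : q ∈ (S.updates p s e).image (fun x => (x.1, x.2.2)) →
      q.2 < q.1 ∧ ∃ u, s ≤ u ∧ u < e ∧ last q ∈ T.red p u := by
    intro hq
    obtain ⟨x, hx, rfl⟩ := mem_image.1 hq
    obtain ⟨h, -, h2, h3, h4⟩ := hmem x hx
    exact ⟨h.1, _, h2, h3, T.mem_of_compute h4 (luEdge_update_left x h)⟩
  have hC : q ∈ (S.updates p s e).image (fun x => (x.2.2, x.2.1)) →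
      q.1 < q.2 ∧ ∃ u, s ≤ u ∧ u < e ∧ last q ∈ T.red p u := by
    intro hq
    obtain ⟨x, hx, rfl⟩ := mem_image.1 hq
    obtain ⟨h, -, h2, h3, h4⟩ := hmem x hx
    exact ⟨h.2, _, h2, h3, T.mem_of_compute h4 (luEdge_update_right x h)⟩
  have hone : (∃ u, s ≤ u ∧ u < e ∧ last q ∈ T.red p u) → 1 ≤ S.supply p s e q := by
    rintro ⟨u, h1, h2, h3⟩
    exact one_le_supply h1 h2.le h3
  have hA : q ∈ (S.updates p s e).image (fun x => (x.1, x.2.1)) → 1 ≤ S.supply p s e q ∧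
      ((∃ u, s ≤ u ∧ u < e ∧ last q ∈ T.red p u) → 2 ≤ S.supply p s e q) := by
    intro hq
    obtain ⟨x, hx, rfl⟩ := mem_image.1 hq
    obtain ⟨h, h1, h2, h3, h4⟩ := hmem x hx
    refine ⟨one_le_supply h2 h3.le (pred_mem_of_compute h4), ?_⟩
    rintro ⟨u, h5, h6, h7⟩
    exact two_le_supply (v := update x h) (Nat.le_add_left _ _) h1 h2 h3 h5 h6 h7
  have hBC := fun hb hc => lt_asymm (hB hb).1 (hC hc).1
  split_ifs with ha hb hc hc hb hc hc
  · exact absurd hc (hBC hb)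
  · exact (hA ha).2 (hB hb).2
  · exact (hA ha).2 (hC hc).2
  · exact (hA ha).1
  · exact absurd hc (hBC hb)
  · exact hone (hB hb).2
  · exact hone (hC hc).2
  · exact Nat.zero_le _

theorem sq_card_updates_le (p : Fin P) (s e : ℕ) :
    27 * (S.updates p s e).card ^ 2 ≤ ((T.red p s).card + S.events p s e) ^ 3 := by
  have h1 := (S.updates p s e).sq_card_le_card_mul_card_mul_card
  have h2 := card_projections_le (S := S) p s e
  generalize ((S.updates p s e).image fun x => (x.1, x.2.1)).card = a at *
  generalize ((S.updates p s e).image fun x => (x.1, x.2.2)).card = b at *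
  generalize ((S.updates p s e).image fun x => (x.2.2, x.2.1)).card = c at *
  refine le_trans ?_ (Nat.pow_le_pow_left h2 3)
  refine (Nat.mul_le_mul_left 27 h1).trans ?_
  have h : (27 : ℝ) * (a * (b * c)) ≤ (a + (b + c)) ^ 3 := by
    have ha : (0 : ℝ) ≤ a := a.cast_nonneg
    have hb : (0 : ℝ) ≤ b := b.cast_nonneg
    have hc : (0 : ℝ) ≤ c := c.cast_nonneg
    nlinarith [mul_nonneg ha (sq_nonneg ((b : ℝ) - c)), mul_nonneg hb (sq_nonneg ((a : ℝ) - c)),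
      mul_nonneg hc (sq_nonneg ((a : ℝ) - b)), mul_nonneg ha (sq_nonneg ((a : ℝ) - b)),
      mul_nonneg ha (sq_nonneg ((a : ℝ) - c)), mul_nonneg hb (sq_nonneg ((b : ℝ) - c)),
      mul_nonneg hb (sq_nonneg ((b : ℝ) - a)), mul_nonneg hc (sq_nonneg ((c : ℝ) - a)),
      mul_nonneg hc (sq_nonneg ((c : ℝ) - b))]
  exact_mod_cast h

/-! ### Cutting time into windows of events -/

theorem events_add (p : Fin P) {s u e : ℕ} (h1 : s ≤ u) (h2 : u ≤ e) :
    S.events p s e = S.events p s u + S.events p u e := by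
  classical
  unfold events
  rw [← card_union_of_disjoint, ← filter_union, Ico_union_Ico_eq_Ico h1 h2]
  exact disjoint_filter_filter (Ico_disjoint_Ico_consecutive s u e)

theorem events_succ_le (p : Fin P) (t : ℕ) : S.events p 0 (t + 1) ≤ S.events p 0 t + 1 := by
  classical
  rw [events_add p (Nat.zero_le t) (t.le_add_right 1)]
  unfold events
  have := card_filter_le (Ico t (t + 1)) fun t => ∃ q, S.EventAt p t q
  simp only [Nat.card_Ico] at this
  omega

theorem exists_events_eq (p : Fin P) (t y : ℕ) (h : y ≤ S.events p 0 t) :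
    ∃ s ≤ t, S.events p 0 s = y := by
  induction t with
  | zero =>
    have : S.events p 0 0 = 0 := by simp [events]
    exact ⟨0, le_rfl, by omega⟩
  | succ t ih =>
    by_cases hy : y ≤ S.events p 0 t
    · obtain ⟨s, hs, h'⟩ := ih hy
      exact ⟨s, by omega, h'⟩
    · have := events_succ_le (S := S) p t
      exact ⟨t + 1, le_rfl, by omega⟩

theorem card_updates_le_add (p : Fin P) (s u e : ℕ) :
    (S.updates p s e).card ≤ (S.updates p s u).card + (S.updates p u e).card := by
  classical
  refine (card_le_card fun x hx => ?_).trans (card_union_le _ _)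
  obtain ⟨h, h1, h2, h3⟩ := (mem_filter.1 hx).2
  rcases lt_or_ge (S.time (update x h)) u with hu | hu
  · exact mem_union_left _ (mem_filter.2 ⟨mem_univ _, h, h1, h2, hu⟩)
  · exact mem_union_right _ (mem_filter.2 ⟨mem_univ _, h, h1, hu, h3⟩)

/-- The constant `3/5` is a round value just below `1 - 2/√27`: for `27 * w ^ 2 = x ^ 3` and `x = m`
the claim amounts to `4/27 ≤ (2/5)^2`. -/
theorem two_mul_le_of_sq_le {w x m : ℝ} (hx : 0 ≤ x) (hm : 0 ≤ m) (hxm : x ≤ 3 * m)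
    (h : 27 * w ^ 2 ≤ x ^ 3) : 2 * w ≤ √m * (x - 3 / 5 * min x m) := by
  have hnn : 0 ≤ x - 3 / 5 * min x m := by
    have := min_le_left x m
    linarith
  refine le_of_sq_le_sq ?_ (mul_nonneg (Real.sqrt_nonneg m) hnn)
  rw [mul_pow, mul_pow, Real.sq_sqrt hm]
  rcases le_total x m with hc | hc
  · rw [min_eq_left hc]
    nlinarith [mul_nonneg (sq_nonneg x) (sub_nonneg.2 hc), pow_nonneg hx 3]
  · rw [min_eq_right hc]
    obtain ⟨a, rfl⟩ : ∃ a, x = m + a := ⟨x - m, by ring⟩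
    have ha : 0 ≤ a := by linarith
    have hb : 0 ≤ 2 * m - a := by linarith
    nlinarith [mul_nonneg (mul_nonneg ha hm) hb, mul_nonneg (mul_nonneg ha ha) hb,
      pow_nonneg hm 3, mul_nonneg ha (sq_nonneg m), mul_nonneg hm (sq_nonneg a)]

/-- The work of a processor in terms of its events. The saving `min x M` is due to the empty fast
memory at the beginning. -/
theorem two_mul_card_updates_le (hM : 0 < M) (p : Fin P) (t : ℕ) :
    2 * ((S.updates p 0 t).card : ℝ) ≤
      √M * (S.events p 0 t - 3 / 5 * min (S.events p 0 t : ℝ) M) := by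
  induction hn : S.events p 0 t using Nat.strong_induction_on generalizing t with
  | _ n ih =>
    subst hn
    have hM' : (0 : ℝ) < M := Nat.cast_pos.2 hM
    by_cases hle : S.events p 0 t ≤ 3 * M
    · refine two_mul_le_of_sq_le (Nat.cast_nonneg _) hM'.le (by exact_mod_cast hle) ?_
      have := sq_card_updates_le (S := S) p 0 t
      rw [T.red_zero, card_empty, zero_add] at this
      exact_mod_cast this
    -- Cut off the last `2M` events: with at most `M` pebbles at `s` they allow at most `√M * M`
    -- updates. More than `M` events remain, so the minimum is `M` before and after the cut.
    · obtain ⟨s, hst, hs⟩ := exists_events_eq (S := S) p t (S.events p 0 t - 2 * M) (by omega)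
      have h1 := ih _ (by omega : S.events p 0 s < _) s rfl
      have h2 := events_add (S := S) p (Nat.zero_le s) hst
      have h3 : S.events p s t = 2 * M := by omega
      have h4 := sq_card_updates_le (S := S) p s t
      have h5 : 27 * (S.updates p s t).card ^ 2 ≤ (3 * M) ^ 3 := by
        refine h4.trans (Nat.pow_le_pow_left ?_ 3)
        have := T.card_red_le p s
        omega
      have h6 : ((S.updates p s t).card : ℝ) ≤ √M * M := by
        refine le_of_sq_le_sq ?_ (by positivity)
        rw [mul_pow, Real.sq_sqrt hM'.le]
        have : (27 : ℝ) * ((S.updates p s t).card : ℝ) ^ 2 ≤ (3 * M) ^ 3 := by exact_mod_cast h5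
        nlinarith
      have h7 : ((S.updates p 0 t).card : ℝ) ≤
          (S.updates p 0 s).card + (S.updates p s t).card := by
        exact_mod_cast card_updates_le_add (S := S) p 0 s t
      have h8 : (S.events p 0 t : ℝ) = S.events p 0 s + 2 * M := by
        rw [h2, h3]; push_cast; ring
      have h9 : (M : ℝ) ≤ S.events p 0 s := by
        have : M ≤ S.events p 0 s := by omega
        exact_mod_cast this
      rw [min_eq_right h9] at h1
      rw [min_eq_right (by linarith), h8]
      nlinarith

end LUTrace.Schedule

/-! ## The lower bound -/

theorem List.countP_eq_card_filter_range {α : Type*} (f : α → Bool) (l : List α) :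
    l.countP f = ({t ∈ Finset.range l.length | l[t]?.any f = true}).card := by
  induction l using List.reverseRecOn with
  | nil => simp
  | append_singleton l a ih =>
    have h1 : ({t ∈ Finset.range l.length | (l ++ [a])[t]?.any f = true}) =
        {t ∈ Finset.range l.length | l[t]?.any f = true} := by
      refine Finset.filter_congr fun t ht => ?_
      rw [List.getElem?_append_left (Finset.mem_range.1 ht)]
    rw [List.countP_append, List.length_append, List.length_singleton, Finset.range_add_one,
      Finset.filter_insert, h1, ih]
    by_cases ha : f a = true <;> simp [ha]

/-- Iteration `k` contributes `(N - 1 - k) ^ 2` updates. -/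
theorem three_mul_card_updates (N : ℕ) :
    3 * ((Finset.univ.filter fun x : Fin N × Fin N × Fin N =>
      x.2.2 < x.1 ∧ x.2.2 < x.2.1).card : ℝ) = N * (N - 1) * (2 * N - 1) / 2 := by
  have h1 : (Finset.univ.filter fun x : Fin N × Fin N × Fin N =>
      x.2.2 < x.1 ∧ x.2.2 < x.2.1).card = ∑ m ∈ Finset.range N, m ^ 2 := by
    rw [← Finset.sum_range_reflect, Finset.sum_range fun j => (N - 1 - j) ^ 2,
      Finset.card_eq_sum_card_fiberwise (f := fun x => x.2.2) fun _ _ => Finset.mem_univ _]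
    refine Finset.sum_congr rfl fun k _ => ?_
    rw [sq, ← Fin.card_Ioi, ← Finset.card_product]
    refine Finset.card_bij' (fun x _ => (x.1, x.2.1)) (fun y _ => (y.1, y.2, k)) ?_ ?_ ?_ ?_
    · rintro ⟨i, j, k'⟩ hx
      simp only [Finset.mem_filter, Finset.mem_univ, true_and] at hx
      obtain ⟨hx, rfl⟩ := hx
      simpa using hx
    · rintro ⟨i, j⟩ hy
      simpa using hy
    · rintro ⟨i, j, k'⟩ hx
      simp only [Finset.mem_filter, Finset.mem_univ, true_and] at hx
      rw [← hx.2]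
    · rintro ⟨i, j⟩ _
      rfl
  rw [h1]
  push_cast
  clear h1
  induction N with
  | zero => simp
  | succ n ih =>
    rw [Finset.sum_range_succ, mul_add, ih]
    push_cast
    ring

theorem card_row_ne_zero (N : ℕ) :
    (Finset.univ.filter fun q : Fin N × Fin N => (q.1 : ℕ) ≠ 0).card = (N - 1) * N := by
  cases N with
  | zero => rfl
  | succ n =>
    have : (Finset.univ.filter fun q : Fin (n + 1) × Fin (n + 1) => (q.1 : ℕ) ≠ 0) =
        (Finset.univ.erase 0) ×ˢ Finset.univ := by
      ext q
      simp only [Finset.mem_filter, Finset.mem_univ, Finset.mem_product, Finset.mem_erase,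
        true_and, and_true, ne_eq, Fin.ext_iff, Fin.val_zero]
    rw [this, Finset.card_product, Finset.card_erase_of_mem (Finset.mem_univ _)]
    simp

/-- Combination of the two counting arguments: the processors that are hardly used are charged
for a small share of the work, the others profit from their empty memory at the beginning. -/
theorem sum_add_half_le_card_mul {ι : Type*} [Fintype ι] [Nonempty ι] {Q M s : ℝ}
    {c x l f st : ι → ℝ}
    (hQ : ∀ i, l i + st i ≤ Q) (hst : ∀ i, st i ≤ l i) (hx : ∀ i, x i ≤ l i + f i)
    (hl : ∀ i, l i ≤ x i) (hf0 : ∀ i, 0 ≤ f i) (hc : ∀ i, c i ≤ x i - 3 / 5 * min (x i) M)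
    (hf : ∑ i, f i ≤ s) (hs : ∑ i, st i = s) (hs0 : 0 ≤ s) (hsM : s ≤ Fintype.card ι * M) :
    ∑ i, c i + s / 2 ≤ Fintype.card ι * Q := by
  have hP : (0 : ℝ) < Fintype.card ι := Nat.cast_pos.2 Fintype.card_pos
  set n := s / Fintype.card ι with hn
  have hnP : Fintype.card ι * n = s := by rw [hn]; field_simp
  have hnM : n ≤ M := by rw [hn, div_le_iff₀ hP]; linarith
  have hsumQ : ∑ _i : ι, Q = Fintype.card ι * Q := by simp
  have hQn : 2 * n ≤ Q := by
    have h : ∑ i, 2 * st i ≤ ∑ _i : ι, Q :=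
      Finset.sum_le_sum fun i _ => by linarith [hQ i, hst i]
    rw [← Finset.mul_sum, hs, hsumQ, ← hnP] at h
    nlinarith
  have hB : ∑ i, (c i + st i - f i + 3 / 5 * min (x i) M) ≤ ∑ _i : ι, Q :=
    Finset.sum_le_sum fun i _ => by linarith [hQ i, hx i, hc i]
  -- For `x i ≤ M`, `c i ≤ 2/5 * x i` and `st i ≤ x i` reduce the claim to `2 * n ≤ Q`. For `x i ≥
  -- M`, the terms `3/5 * M` and `7/5 * M` add up to `2 * M ≥ 2 * n`.
  have hA : ∑ i, (c i + st i - f i + 2 * n - 7 / 5 * min (x i) M) ≤ ∑ _i : ι, Q := by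
    refine Finset.sum_le_sum fun i _ => ?_
    have h := hc i
    rcases le_total (x i) M with hxM | hxM
    · rw [min_eq_left hxM] at h ⊢
      linarith [hst i, hl i, hf0 i]
    · rw [min_eq_right hxM] at h ⊢
      linarith [hQ i, hx i]
  rw [hsumQ] at hA hB
  simp only [Finset.sum_add_distrib, Finset.sum_sub_distrib, ← Finset.mul_sum, hs,
    Finset.sum_const, Finset.card_univ, nsmul_eq_mul] at hA hB
  -- The weights `7/10` on `hB` and `3/10` on `hA` cancel the minima and leave a gain of `3/5 * s`.
  nlinarith

open LUVertex Finset in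
theorem card_mul_pebblingIO_ge {N P M : ℕ} (hP : 0 < P) (hM : 0 < M) (hPM : N ^ 2 ≤ P * M)
    {ms : List (PebbleMove P (LUVertex N))} (h : (luCDAG N).IsPebbling P M ms) :
    2 * ((univ.filter fun x : Fin N × Fin N × Fin N =>
      x.2.2 < x.1 ∧ x.2.2 < x.2.1).card : ℝ) / √M + (N : ℝ) * (N - 1) / 2 ≤
      P * (pebblingIO ms : ℝ) := by
  classical
  obtain ⟨T, hlen, hmove⟩ := h.exists_trace
  obtain ⟨S⟩ := T.nonempty_schedule hP
  have : Nonempty (Fin P) := ⟨⟨0, hP⟩⟩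
  have hsto : ∀ q : Fin N × Fin N, ∃ (p : Fin P) (t : ℕ), (q.1 : ℕ) ≠ 0 →
      T.move t = some (.store p (last q)) := by
    intro q
    by_cases hq : (q.1 : ℕ) = 0
    · exact ⟨⟨0, hP⟩, 0, fun h => absurd hq h⟩
    · obtain ⟨p, t, h⟩ := T.exists_store q hq
      exact ⟨p, t, fun _ => h⟩
  choose σp σt hσ using hsto
  let loads (p : Fin P) : Finset ℕ := {t ∈ range T.length | ∃ v, T.move t = some (.load p v)}
  let stores (p : Fin P) : Finset (Fin N × Fin N) := {q | (q.1 : ℕ) ≠ 0 ∧ σp q = p}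
  let finals (p : Fin P) : Finset (Fin N × Fin N) := {q | (q.1 : ℕ) ≠ 0 ∧ S.finalProc q = p}
  have hfib : ∀ g : Fin N × Fin N → Fin P,
      ∑ p, #{q : Fin N × Fin N | (q.1 : ℕ) ≠ 0 ∧ g q = p} = (N - 1) * N := by
    intro g
    rw [← card_row_ne_zero, card_eq_sum_card_fiberwise (f := g) fun _ _ => mem_univ _]
    simp only [filter_filter]
  have hinj : ∀ p, Set.InjOn σt (stores p) := by
    intro p q hq q' hq' heq
    obtain ⟨h1, h2⟩ := (mem_filter.1 (mem_coe.1 hq)).2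
    obtain ⟨h3, h4⟩ := (mem_filter.1 (mem_coe.1 hq')).2
    have h5 := hσ q h1
    rw [heq, hσ q' h3] at h5
    simp only [Option.some.injEq, PebbleMove.store.injEq] at h5
    simpa using (congrArg pos h5.2).symm
  -- The memory is empty at first, so a stored element had some version loaded by the same
  -- processor; distinct elements need distinct loads.
  have hstl : ∀ p, #(stores p) ≤ #(loads p) := by
    intro p
    have hex : ∀ q : Fin N × Fin N, ∃ t, q ∈ stores p →
        t ∈ loads p ∧ ∃ w : LUVertex N, T.move t = some (.load p w) ∧ w.pos = q := by
      intro q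
      by_cases hq : q ∈ stores p
      · obtain ⟨h1, h2⟩ := (mem_filter.1 hq).2
        have hmem := T.mem_of_store (hσ q h1)
        rw [h2] at hmem
        rcases LUTrace.Schedule.exists_copy (Nat.zero_le _) hmem with
          ⟨w, hw, -⟩ | ⟨t, w, -, -, h3, h4⟩
        · simp [T.red_zero] at hw
        · exact ⟨t, fun _ => ⟨mem_filter.2 ⟨mem_range.2 (T.lt_length h3), w, h3⟩, w, h3, h4⟩⟩
      · exact ⟨0, fun h => absurd h hq⟩
    choose g hg using hex
    refine card_le_card_of_injOn g (fun q hq => (hg q hq).1) fun q hq q' hq' heq => ?_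
    obtain ⟨-, w, h1, rfl⟩ := hg q hq
    obtain ⟨-, w', h2, rfl⟩ := hg q' hq'
    rw [heq, h2] at h1
    simp only [Option.some.injEq, PebbleMove.load.injEq] at h1
    rw [h1.2]
  have hQ : ∀ p, #(loads p) + #(stores p) ≤ pebblingIO ms := by
    intro p
    refine le_trans ?_ (le_sup (f := fun p : Fin P => ms.countP (PebbleMove.isIO p))
      (mem_univ p))
    change _ ≤ ms.countP (PebbleMove.isIO p)
    rw [← card_image_of_injOn (hinj p), ← card_union_of_disjoint,
      List.countP_eq_card_filter_range]
    · refine card_le_card fun t ht => ?_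
      rcases mem_union.1 ht with ht | ht
      · obtain ⟨h1, v, h2⟩ := mem_filter.1 ht
        exact mem_filter.2 ⟨by rwa [← hlen], by rw [← hmove, h2]; simp [PebbleMove.isIO]⟩
      · obtain ⟨q, hq, rfl⟩ := mem_image.1 ht
        obtain ⟨h1, h2⟩ := (mem_filter.1 hq).2
        have h3 := hσ q h1
        exact mem_filter.2 ⟨by rw [← hlen]; exact mem_range.2 (T.lt_length h3),
          by rw [← hmove, h3]; simp [PebbleMove.isIO, h2]⟩
    · rw [disjoint_left]
      intro t ht ht'
      obtain ⟨-, v, h2⟩ := mem_filter.1 ht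
      obtain ⟨q, hq, rfl⟩ := mem_image.1 ht'
      have h3 := hσ q (mem_filter.1 hq).2.1
      rw [h2] at h3
      simp at h3
  have hx : ∀ p, S.events p 0 T.length ≤ #(loads p) + #(finals p) := by
    intro p
    refine le_trans (card_le_card (t := loads p ∪ (finals p).image S.finalTime) ?_)
      ((card_union_le _ _).trans (Nat.add_le_add_left card_image_le _))
    intro t ht
    obtain ⟨h1, q, ⟨v, -, hv⟩ | ⟨h2, h3, h4⟩⟩ := mem_filter.1 ht
    · exact mem_union_left _ (mem_filter.2 ⟨mem_range.2 (mem_Ico.1 h1).2, v, hv⟩)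
    · exact mem_union_right _ (mem_image.2 ⟨q, mem_filter.2 ⟨mem_univ _, h2, h3⟩, h4⟩)
  have hl : ∀ p, #(loads p) ≤ S.events p 0 T.length := by
    intro p
    refine card_le_card fun t ht => ?_
    obtain ⟨h1, v, hv⟩ := mem_filter.1 ht
    exact mem_filter.2 ⟨mem_Ico.2 ⟨Nat.zero_le _, mem_range.1 h1⟩, v.pos, .inl ⟨v, rfl, hv⟩⟩
  have hW : #{x : Fin N × Fin N × Fin N | x.2.2 < x.1 ∧ x.2.2 < x.2.1} ≤
      ∑ p, #(S.updates p 0 T.length) := by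
    refine le_trans (card_le_card fun x hx => ?_) card_biUnion_le
    have hlt := (mem_filter.1 hx).2
    exact mem_biUnion.2 ⟨S.proc (update x hlt), mem_univ _, mem_filter.2 ⟨mem_univ _, hlt, rfl,
      Nat.zero_le _, T.lt_length (S.move_time _ (Nat.le_add_left _ _))⟩⟩
  have hsq : (0 : ℝ) < √M := Real.sqrt_pos.2 (Nat.cast_pos.2 hM)
  have hN : (((N - 1) * N : ℕ) : ℝ) = N * (N - 1) := by
    cases N with
    | zero => simp
    | succ n => push_cast; simp; ring
  have hS : ((N : ℝ) * (N - 1)) ≤ P * M := by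
    have : (N : ℝ) ^ 2 ≤ P * M := by exact_mod_cast hPM
    nlinarith [(Nat.cast_nonneg N : (0 : ℝ) ≤ N)]
  have key := sum_add_half_le_card_mul (ι := Fin P) (Q := pebblingIO ms) (M := M)
    (s := N * (N - 1)) (c := fun p => 2 * (#(S.updates p 0 T.length) : ℝ) / √M)
    (x := fun p => S.events p 0 T.length) (l := fun p => #(loads p)) (f := fun p => #(finals p))
    (st := fun p => #(stores p)) (fun p => by exact_mod_cast hQ p)
    (fun p => by exact_mod_cast hstl p) (fun p => by exact_mod_cast hx p)
    (fun p => by exact_mod_cast hl p) (fun p => Nat.cast_nonneg _)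
    (fun p => (div_le_iff₀' hsq).2 (LUTrace.Schedule.two_mul_card_updates_le hM p T.length))
    (by rw [← hN, ← Nat.cast_sum, hfib S.finalProc]) (by rw [← hN, ← Nat.cast_sum, hfib σp])
    (by rw [← hN]; exact Nat.cast_nonneg _) (by simpa using hS)
  rw [Fintype.card_fin, ← Finset.sum_div, ← Finset.mul_sum, ← Nat.cast_sum] at key
  refine le_trans ?_ key
  gcongr

theorem luBound_le_pebblingIO {N P M : ℕ} (hP : 0 < P) (hPM : N ^ 2 ≤ P * M)
    {ms : List (PebbleMove P (LUVertex N))} (h : (luCDAG N).IsPebbling P M ms) :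
    luBound N P M ≤ (pebblingIO ms : ℝ) := by
  have hP' : (0 : ℝ) < P := Nat.cast_pos.2 hP
  rcases Nat.eq_zero_or_pos M with rfl | hM
  · obtain rfl : N = 0 := by simpa using hPM
    simp [luBound]
  · have hsq : (0 : ℝ) < √M := Real.sqrt_pos.2 (Nat.cast_pos.2 hM)
    have key := card_mul_pebblingIO_ge hP hM hPM h
    have hW := three_mul_card_updates N
    generalize ((Finset.univ.filter fun x : Fin N × Fin N × Fin N =>
      x.2.2 < x.1 ∧ x.2.2 < x.2.1).card : ℝ) = W at key hW
    have hNN : (0 : ℝ) ≤ N * (N - 1) := by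
      rcases Nat.eq_zero_or_pos N with rfl | hN
      · simp
      · have : (1 : ℝ) ≤ N := by exact_mod_cast hN
        exact mul_nonneg (by linarith) (by linarith)
    have heq : luBound N P M =
        ((2 * (N : ℝ) ^ 3 - 6 * (N : ℝ) ^ 2 + 4 * N) / 3 / √M + (N : ℝ) * (N - 1) / 2) / P := by
      unfold luBound
      field_simp
    rw [heq, div_le_iff₀ hP', mul_comm (pebblingIO ms : ℝ)]
    refine le_trans ?_ key
    gcongr
    -- The exact count gives `2 * W = (2N³ - 3N² + N) / 3`, which exceeds the stated numerator over
    -- `3` by `N(N-1)`.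
    nlinarith

/-! ### The asymptotic form of the bound -/

theorem abs_luBound_sub_le {N P M : ℕ} (hP : 0 < P) (hM : 0 < M) :
    |luBound N P M - 2 * (N : ℝ) ^ 3 / (3 * (P : ℝ) * Real.sqrt (M : ℝ))| ≤
      4 * ((N : ℝ) ^ 2 / (P : ℝ)) := by
  have hP' : (0 : ℝ) < P := Nat.cast_pos.2 hP
  have hsq : (1 : ℝ) ≤ √M := Real.one_le_sqrt.2 (by exact_mod_cast hM)
  have hsq0 : (0 : ℝ) < √M := by linarith
  have hN0 : (0 : ℝ) ≤ N := N.cast_nonneg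
  have hN : (N : ℝ) ≤ (N : ℝ) ^ 2 := by exact_mod_cast Nat.le_self_pow two_ne_zero N
  have heq : luBound N P M - 2 * (N : ℝ) ^ 3 / (3 * (P : ℝ) * Real.sqrt (M : ℝ)) =
      ((4 * N - 6 * (N : ℝ) ^ 2) / 3 / √M + (N : ℝ) * (N - 1) / 2) / P := by
    unfold luBound
    field_simp
    ring
  have h1 : |(4 * N - 6 * (N : ℝ) ^ 2) / 3 / √M| ≤ 2 * (N : ℝ) ^ 2 := by
    rw [abs_div, abs_of_pos hsq0, div_le_iff₀ hsq0]
    have : |(4 * N - 6 * (N : ℝ) ^ 2) / 3| ≤ 2 * (N : ℝ) ^ 2 := by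
      rw [abs_le]
      constructor <;> linarith
    nlinarith [sq_nonneg (N : ℝ)]
  have h2 : |(N : ℝ) * (N - 1) / 2| ≤ 2 * (N : ℝ) ^ 2 := by
    rw [abs_le]
    constructor <;> nlinarith
  rw [heq, abs_div, abs_of_pos hP', ← mul_div_assoc]
  gcongr
  exact (abs_add_le _ _).trans (by linarith)

theorem mainTheorem1 :
    (∀ N P M : ℕ, 0 < P → N ^ 2 ≤ P * M →
      ∀ ms : List (PebbleMove P (LUVertex N)), (luCDAG N).IsPebbling P M ms →
        luBound N P M ≤ (pebblingIO ms : ℝ)) ∧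
    (∃ C : ℝ, ∀ N P M : ℕ, 0 < P → 0 < M →
      |luBound N P M - 2 * (N : ℝ) ^ 3 / (3 * (P : ℝ) * Real.sqrt (M : ℝ))| ≤
        C * ((N : ℝ) ^ 2 / (P : ℝ))) :=
  ⟨fun _ _ _ hP hPM _ h => luBound_le_pebblingIO hP hPM h,
    4, fun _ _ _ hP hM => abs_luBound_sub_le hP hM⟩
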